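/- A black box group is a finite group $G$ whose elements are encoded by bit strings of a uniform length (every element has at least one code), with an oracle that multiplies two codes, inverts a code, and tests whether a code represents the identity (each call is one group operation; a code of the identity is available for free). A $G$-valued random variable $X$ is $\varepsilon$-uniform if $|\Pr(X=g)-1/|G||\le\varepsilon/|G|$ for all $g\in G$. For a list $h_1,\dots,h_m$ in $G$, the cube of the list is the random subproduct $h_1^{E_1}\cdots h_m^{E_m}$ with independent fair bits $E_i\in\{0,1\}$. Let $G=\langle S\rangle$, where $S$ is a finite list of generators, and let $L\in\mathbb N$, $|G|\le L$, be an a priori bound known to the algorithm ($L=|G|$ is allowed). Let $p=(p_1,p_2,p_3)$ be a probability vector with all $p_j>0$. The *Fibonacci cube algorithm* with parameters $p$ and $t,s\in\mathbb N$ is the following. Start with the empty cube, $R_0=1$. In each of $t$ steps choose, independently of everything else, $j\in\{1,2,3\}$ with probability $p_j$: if $j=1$, draw $g$ from the distribution of $R_i$ and put $R_{i+1}=R_i\,g^{E}$; if $j=2$, draw $g$ from the distribution of $R_i$ and put $R_{i+1}=g^{E}R_i$; if $j=3$, let $g$ be a random subproduct on $S$ and put $R_{i+1}=R_i\,g^{E}$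 ($E$ a new fair bit). If $R_t$ is the cube of $h_1,\dots,h_t$, let $W$ be the cube of $h_t^{-1},\dots,h_1^{-1},h_1,\dots,h_t$ (that is, $R_t^{-1}\overline R_t$ with $\overline R_t$ an independent copy of $R_t$). Draw $g_1,\dots,g_s$ independently from $W$, and let $Y$ be the cube of $h_t^{-1},\dots,h_1^{-1},h_1,\dots,h_t,g_1,\dots,g_s$. For $k\in\mathbb N$ let $X_k$ be the product of $k$ independent copies of $Y$. **Theorem.** For every $p$ as above and every $\kappa\in\mathbb N$ there are constants $\tau,\sigma,C>0$ and $\gamma\in(0,1)$, depending only on $p$ and $\kappa$, such that for every black box group $G=\langle S\rangle$ and every integer $L\ge|G|$, the algorithm with $t=\lceil\tau\log L\rceil$ and $s=\lceil\sigma\log L\rceil$ has the following properties. 1. Every run of the construction of $Y$ uses at most $C(\log^2L+|S|\log L)$ group operations. 2. For every possible result $Y$ of the construction and every $0<\varepsilon<1$, with $k=\lceil\log\varepsilon/\log\gamma\rceil$, every draw of an element from the distribution of $X_k$ uses at most $C\,(1+\log(1/\varepsilon))\log L$ group operations. 3. With probability at least $1-L^{-\kappa}$ over the random choices of the construction, the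 constructed $Y$ is such that, for all $0<\varepsilon<1$ simultaneously, $X_k$ with $k=\lceil\log\varepsilon/\log\gamma\rceil$ is $\varepsilon$-uniform on $G$. In particular, with $L=|G|$, drawing one element costs $O(\log(1/\varepsilon)\log|G|)$ group operations (for $\varepsilon\le1/2$) and the construction costs $O(\log^2|G|+|S|\log|G|)$ group operations; if $|G|$ is not known a priori, $|G|$ is replaced by $L$. -/

import Mathlib

/-- A black box group structure on `G`: the elements of `G` are encoded by bit strings of a uniform
length `len` (every element has at least one code, codes need not be unique), and an oracle
multiplies, inverts and compares with the identity on the level of codes. -/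
structure BlackBoxGroup (G : Type*) [Group G] where
  len : ℕ
  codes : Set (Fin len → Bool)
  val : codes → G
  val_surjective : Function.Surjective val
  one : codes
  val_one : val one = 1
  mul : codes → codes → codes
  val_mul : ∀ x y, val (mul x y) = val x * val y
  inv : codes → codes
  val_inv : ∀ x, val (inv x) = (val x)⁻¹
  isOne : codes → Bool
  isOne_iff : ∀ x, isOne x = true ↔ val x = 1

/-- Randomized black box programs that handle codes of type `H` and return a value of type `α`.
A program can obtain codes only from its input and from the oracle: `one` is the code of the
identity, `mul`, `inv`, `isOne` are oracle calls, and `rand n μ` is a random choice in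
`{0, …, n - 1}` with distribution `μ`, independent of all other random choices. -/
inductive BBProg (H : Type) (α : Type) : Type
  | ret (a : α) : BBProg H α
  | one (k : H → BBProg H α) : BBProg H α
  | mul (x y : H) (k : H → BBProg H α) : BBProg H α
  | inv (x : H) (k : H → BBProg H α) : BBProg H α
  | isOne (x : H) (k : Bool → BBProg H α) : BBProg H α
  | rand (n : ℕ) (μ : PMF (Fin n)) (k : Fin n → BBProg H α) : BBProg H α

/-- Execution of a program on a black box group: the joint distribution of the returned value and
of the number of group operations (oracle calls) used in the run. -/
noncomputable def BlackBoxGroup.run {G : Type*} [Group G] (B : BlackBoxGroup G) {α : Type} :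
    BBProg B.codes α → PMF (α × ℕ)
  | .ret a => PMF.pure (a, 0)
  | .one k => B.run (k B.one)
  | .mul x y k => (B.run (k (B.mul x y))).map fun o => (o.1, o.2 + 1)
  | .inv x k => (B.run (k (B.inv x))).map fun o => (o.1, o.2 + 1)
  | .isOne x k => (B.run (k (B.isOne x))).map fun o => (o.1, o.2 + 1)
  | .rand _ μ k => μ.bind fun i => B.run (k i)

/-- The `G`-valued random variable (as a distribution on `G`) computed by a program. -/
noncomputable def BlackBoxGroup.law {G : Type*} [Group G] (B : BlackBoxGroup G)
    (P : BBProg B.codes B.codes) : PMF G :=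
  (B.run P).map fun o => B.val o.1

/-- `|Pr(X = g) - 1/|G|| ≤ ε/|G|` for all `g`, for a random variable `X` with distribution `μ`. -/
def IsEpsUniform {G : Type*} (ε : ℝ) (μ : PMF G) : Prop :=
  ∀ g : G, |(μ g).toReal - 1 / (Nat.card G : ℝ)| ≤ ε / (Nat.card G : ℝ)

namespace BBProg

variable {H : Type}

/-- Run `P`, then continue with its result. -/
def bind {α β : Type} : BBProg H α → (α → BBProg H β) → BBProg H β
  | ret a, f => f a
  | one k, f => one fun x => bind (k x) f
  | mul x y k, f => mul x y fun z => bind (k z) f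
  | inv x k, f => inv x fun z => bind (k z) f
  | isOne x k, f => isOne x fun b => bind (k b) f
  | rand n μ k, f => rand n μ fun i => bind (k i) f

/-- `acc * g₁ ^ E₁ * ⋯ * gₖ ^ Eₖ` with independent fair bits `Eᵢ`. -/
noncomputable def subproductFrom : H → List H → BBProg H H
  | acc, [] => ret acc
  | acc, g :: l => rand 2 (PMF.uniformOfFintype (Fin 2)) fun e =>
      if e = 0 then subproductFrom acc l else mul acc g fun acc' => subproductFrom acc' l

/-- A random subproduct `g₁ ^ E₁ * ⋯ * gₖ ^ Eₖ` on the list `[g₁, …, gₖ]`. -/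
noncomputable def randomSubproduct (l : List H) : BBProg H H :=
  one fun e => subproductFrom e l

/-- One step of the Fibonacci cube algorithm. The random variable `Rᵢ` is stored as the list
`[h₁, …, hₘ]` with `Rᵢ = h₁ ^ E₁ * ⋯ * hₘ ^ Eₘ`. With probabilities `p 0`, `p 1`, `p 2` one of
three cases is chosen: `g` is drawn from `Rᵢ` and `Rᵢ₊₁ = Rᵢ * g ^ E`; or `g` is drawn from `Rᵢ`
and `Rᵢ₊₁ = g ^ E * Rᵢ`; or `g` is a random subproduct on the generators `S` and
`Rᵢ₊₁ = Rᵢ * g ^ E`. -/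
noncomputable def fibonacciStep (p : PMF (Fin 3)) (S hs : List H) : BBProg H (List H) :=
  rand 3 p fun j =>
    if j = 0 then (randomSubproduct hs).bind fun g => ret (hs ++ [g])
    else if j = 1 then (randomSubproduct hs).bind fun g => ret (g :: hs)
    else (randomSubproduct S).bind fun g => ret (hs ++ [g])

/-- `t` steps of the Fibonacci cube algorithm, started at the constant random variable `1`
(the empty cube). -/
noncomputable def fibonacciCube (p : PMF (Fin 3)) (S : List H) : ℕ → BBProg H (List H)
  | 0 => ret []
  | t + 1 => (fibonacciCube p S t).bind fun hs => fibonacciStep p S hs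

/-- `[h₁, …, hₘ]` is sent to `[hₘ⁻¹, …, h₁⁻¹]`, using `m` inversions. -/
def invReverse : List H → BBProg H (List H)
  | [] => ret []
  | h :: l => inv h fun h' => (invReverse l).bind fun l' => ret (l' ++ [h'])

/-- Given the cube `w` of a random variable `W`, draw `g₁, …, gₛ` independently from `W`; they are
the cube of `Pₛ = g₁ ^ E₁ * ⋯ * gₛ ^ Eₛ`. -/
noncomputable def drawMany (w : List H) : ℕ → BBProg H (List H)
  | 0 => ret []
  | s + 1 => (drawMany w s).bind fun l => (randomSubproduct w).bind fun g => ret (l ++ [g])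

/-- The construction phase. First `t` steps of the Fibonacci cube algorithm yield `R`; then the cube
`w = [hₜ⁻¹, …, h₁⁻¹, h₁, …, hₜ]` of `W = R⁻¹ * R'` (with `R'` an independent copy of `R`) is
computed; then `s` elements are drawn from `W`. The result is the cube of `W * Pₛ`. -/
noncomputable def construct (p : PMF (Fin 3)) (S : List H) (t s : ℕ) : BBProg H (List H) :=
  (fibonacciCube p S t).bind fun hs =>
    (invReverse hs).bind fun hs' =>
      (drawMany (hs' ++ hs) s).bind fun ps => ret (hs' ++ hs ++ ps)

/-- The sampling phase: the product of `k` independent elements drawn from the cube `u`. -/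
noncomputable def draw (k : ℕ) (u : List H) : BBProg H H :=
  randomSubproduct (List.replicate k u).flatten

end BBProg

/-! Let `m` be the mass function of a cube `R`, `N = ∑ m²`, and `autocorr m g = ⟨m, m(· g)⟩ ≤ N`.
Appending `g` turns `N` into `(N + autocorr m g) / 2`, so `N` shrinks unless `m` is almost invariant
under a typical `g`. Suppose it stalls both for draws from `R` and for random subproducts on `S`.
Then the set `A` of almost-periods of `m` carries most of the mass; Cauchy–Schwarz bounds `|A|`
below and `∑ autocorr m = 1` bounds `|A * A|` above, both by about `1 / N`. Doubling below `3 / 2`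
makes `A⁻¹ * A` a subgroup. It is all of `G`, because a random subproduct on `S` avoids any proper
subgroup with probability at least `1 / 2` (`hasGap_of_cubeAvg_autocorr`). Hence `autocorr m ≥ N / 2
≥ 1 / (2|G|)` everywhere; as `autocorr m` is the mass function of `R⁻¹ * R'`, the cube contracts
functions of mean zero (`hasGap_of_autocorr`).

Accordingly `cubePotential`, which is `N` before there is a gap and `0` afterwards, decays
geometrically in expectation. A cube without a gap has `N ≥ 1 / |G|`, so after `t` steps the gap is
missing with probability at most `|G| (1 - δ) ^ t`. Given the gap, each element drawn from `W`
multiplies the squared `L²` distance to uniform by at most `3 / 4` on average. Logarithmically many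
steps of both kinds and Markov's inequality give pointwise relative error at most `1 / 2`;
convolution multiplies relative errors, so `k` factors give `2⁻ᵏ`. -/

/-- The averaging operator of the cube of a list: `cubeAvg l φ x` is the expectation of `φ (x * c)`
for a random subproduct `c` on `l`. -/
noncomputable def cubeAvg {G : Type*} [Group G] : List G → (G → ℝ) → G → ℝ
  | [], φ, x => φ x
  | g :: l, φ, x => (cubeAvg l φ x + cubeAvg l φ (x * g)) / 2

open Classical in
/-- The mass function of the cube of a list. -/
noncomputable def cubeMass {G : Type*} [Group G] : List G → G → ℝ
  | [], x => if x = 1 then 1 else 0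
  | g :: l, x => (cubeMass l x + cubeMass l (g⁻¹ * x)) / 2

/-- The list of inverses in reversed order. -/
def invRev {G : Type*} [Group G] : List G → List G
  | [] => []
  | g :: l => invRev l ++ [g⁻¹]

lemma sum_sq_half_add_le {ι : Type*} [Fintype ι] (a b : ι → ℝ) (h : ∑ x, b x ^ 2 = ∑ x, a x ^ 2) :
    ∑ x, ((a x + b x) / 2) ^ 2 ≤ ∑ x, a x ^ 2 := by
  have : ∑ x, ((a x + b x) / 2) ^ 2 ≤ ∑ x, (a x ^ 2 + b x ^ 2) / 2 :=
    Finset.sum_le_sum fun x _ => by nlinarith [sq_nonneg (a x - b x)]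
  rw [← Finset.sum_div, Finset.sum_add_distrib, h] at this
  linarith

/-! ### Averaging operators, autocorrelation and the spectral gap. -/

section Cube

variable {G : Type*} [Group G]

@[simp] lemma cubeAvg_nil (φ : G → ℝ) : cubeAvg [] φ = φ := rfl

lemma cubeAvg_cons (g : G) (l : List G) (φ : G → ℝ) (x : G) :
    cubeAvg (g :: l) φ x = (cubeAvg l φ x + cubeAvg l φ (x * g)) / 2 := rfl

lemma cubeMass_cons (g : G) (l : List G) (x : G) :
    cubeMass (g :: l) x = (cubeMass l x + cubeMass l (g⁻¹ * x)) / 2 := rfl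

lemma cubeAvg_append (l₁ l₂ : List G) (φ : G → ℝ) :
    cubeAvg (l₁ ++ l₂) φ = cubeAvg l₁ (cubeAvg l₂ φ) := by
  induction l₁ with
  | nil => rfl
  | cons g l ih => funext x; simp only [List.cons_append, cubeAvg_cons, ih]

lemma cubeMass_append_singleton (l : List G) (g x : G) :
    cubeMass (l ++ [g]) x = (cubeMass l x + cubeMass l (x * g⁻¹)) / 2 := by
  induction l generalizing x with
  | nil =>
    have h1 : g⁻¹ * x = 1 ↔ x * g⁻¹ = 1 := by
      rw [inv_mul_eq_one, mul_inv_eq_one, eq_comm]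
    have h2 : (cubeMass [] (g⁻¹ * x) : ℝ) = cubeMass [] (x * g⁻¹) := by
      unfold cubeMass
      by_cases h : x * g⁻¹ = 1
      · rw [if_pos h, if_pos (h1.2 h)]
      · rw [if_neg h, if_neg fun h' => h (h1.1 h')]
    rw [List.nil_append, cubeMass_cons, h2]
  | cons h l ih =>
    simp only [List.cons_append, cubeMass_cons, ih, mul_assoc]; ring

lemma cubeMass_nonneg (l : List G) (x : G) : 0 ≤ cubeMass l x := by
  induction l generalizing x with
  | nil => simp only [cubeMass]; split_ifs <;> norm_num
  | cons g l ih => rw [cubeMass_cons]; linarith [ih x, ih (g⁻¹ * x)]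

/-- If some element of the list is not in `K`, a random subproduct misses `K` with probability at
least `1 / 2`. -/
lemma cubeAvg_indicator_subgroup_le (K : Subgroup G) (l : List G) (hl : ∃ g ∈ l, g ∉ K) (x : G) :
    cubeAvg l ((K : Set G).indicator 1) x ≤ 1 / 2 := by
  have aux : ∀ (l : List G), (∀ g ∈ l, g ∈ K) → ∀ x,
      cubeAvg l ((K : Set G).indicator 1) x = (K : Set G).indicator 1 x := by
    intro l
    induction l with
    | nil => intro _ _; rfl
    | cons g l ih =>
      intro h x
      have hg : g ∈ K := h g (by simp)
      rw [cubeAvg_cons, ih (fun a ha => h a (by simp [ha])), ih (fun a ha => h a (by simp [ha]))]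
      by_cases hx : x ∈ K <;> simp [Set.indicator, K.mul_mem_cancel_right hg, hx]
  induction l generalizing x with
  | nil => simp at hl
  | cons g l ih =>
    rw [cubeAvg_cons]
    -- This isolates the last factor `g` outside `K`: all later factors preserve membership in `K`,
    -- and `x`, `x * g` are not both in `K`.
    by_cases h : ∃ a ∈ l, a ∉ K
    · linarith [ih h x, ih h (x * g)]
    · push Not at h
      have hg : g ∉ K := by
        obtain ⟨a, ha, haK⟩ := hl
        rcases List.mem_cons.1 ha with rfl | ha
        · exact haK
        · exact absurd (h a ha) haK
      rw [aux l h, aux l h]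
      by_cases hx : x ∈ K
      · simp [Set.indicator, K.mul_mem_cancel_left hx, hx, hg]
      · simp only [Set.indicator, SetLike.mem_coe, hx, if_false]
        split_ifs <;> norm_num

variable [Fintype G]

lemma cubeAvg_eq_sum (l : List G) (φ : G → ℝ) (x : G) :
    cubeAvg l φ x = ∑ z, cubeMass l z * φ (x * z) := by
  induction l generalizing x with
  | nil => classical simp [cubeMass]
  | cons g l ih =>
    have : ∑ z, cubeMass l (g⁻¹ * z) * φ (x * z) = ∑ z, cubeMass l z * φ (x * g * z) :=
      (Equiv.sum_comp (Equiv.mulLeft g) _).symm.trans (by simp [mul_assoc])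
    simp only [cubeAvg_cons, cubeMass_cons, ih, ← this, ← Finset.sum_add_distrib, Finset.sum_div]
    exact Finset.sum_congr rfl fun _ _ => by ring

lemma sum_comp_mul_right (φ : G → ℝ) (g : G) : ∑ x, φ (x * g) = ∑ x, φ x :=
  Equiv.sum_comp (Equiv.mulRight g) φ

lemma sum_comp_mul_left (φ : G → ℝ) (g : G) : ∑ x, φ (g * x) = ∑ x, φ x :=
  Equiv.sum_comp (Equiv.mulLeft g) φ

lemma sum_cubeMass (l : List G) : ∑ x, cubeMass l x = 1 := by
  induction l with
  | nil => classical simp [cubeMass]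
  | cons g l ih =>
    simp only [cubeMass_cons, ← Finset.sum_div, Finset.sum_add_distrib,
      sum_comp_mul_left (cubeMass l), ih]
    norm_num

lemma sum_cubeAvg (l : List G) (φ : G → ℝ) : ∑ x, cubeAvg l φ x = ∑ x, φ x := by
  induction l with
  | nil => rfl
  | cons g l ih =>
    simp only [cubeAvg_cons, ← Finset.sum_div, Finset.sum_add_distrib,
      sum_comp_mul_right (cubeAvg l φ), ih]
    ring

lemma sum_sq_cubeAvg_le (l : List G) (φ : G → ℝ) :
    ∑ x, cubeAvg l φ x ^ 2 ≤ ∑ x, φ x ^ 2 := by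
  induction l with
  | nil => rfl
  | cons g l ih =>
    exact (sum_sq_half_add_le _ _ (sum_comp_mul_right (fun x => cubeAvg l φ x ^ 2) g)).trans ih

lemma sum_sq_cubeMass_cons_le (g : G) (l : List G) :
    ∑ x, cubeMass (g :: l) x ^ 2 ≤ ∑ x, cubeMass l x ^ 2 :=
  sum_sq_half_add_le _ _ (sum_comp_mul_left (fun x => cubeMass l x ^ 2) g⁻¹)

/-- The averaging operator of the inverted list is the adjoint. -/
lemma sum_mul_cubeAvg_invRev (l : List G) (φ χ : G → ℝ) :
    ∑ x, φ x * cubeAvg (invRev l) χ x = ∑ x, cubeAvg l φ x * χ x := by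
  induction l generalizing χ with
  | nil => rfl
  | cons g l ih =>
    have h : ∑ x, cubeAvg l φ x * χ (x * g⁻¹) = ∑ x, cubeAvg l φ (x * g) * χ x :=
      (sum_comp_mul_right _ g).symm.trans (by simp)
    simp only [invRev, cubeAvg_append, ih, cubeAvg_cons, cubeAvg_nil, add_div, mul_add, add_mul,
      Finset.sum_add_distrib, mul_div_assoc', div_mul_eq_mul_div, ← Finset.sum_div, h]

lemma sum_mul_cubeAvg_invRev_append (l : List G) (φ : G → ℝ) :
    ∑ x, φ x * cubeAvg (invRev l ++ l) φ x = ∑ x, cubeAvg l φ x ^ 2 := by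
  rw [cubeAvg_append, sum_mul_cubeAvg_invRev]
  exact Finset.sum_congr rfl fun _ _ => by ring

/-- The correlation `⟨φ, φ(· g)⟩`. -/
noncomputable def autocorr (φ : G → ℝ) (g : G) : ℝ := ∑ x, φ x * φ (x * g)

lemma autocorr_inv (φ : G → ℝ) (g : G) : autocorr φ g⁻¹ = autocorr φ g :=
  (sum_comp_mul_right _ g).symm.trans
    (Finset.sum_congr rfl fun x _ => by rw [mul_inv_cancel_right, mul_comm])

lemma sum_sq_sub_eq (φ : G → ℝ) (g : G) :
    ∑ x, (φ (x * g) - φ x) ^ 2 = 2 * (∑ x, φ x ^ 2 - autocorr φ g) := by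
  have h : ∑ x, (φ (x * g) - φ x) ^ 2
      = ∑ x, φ (x * g) ^ 2 + ∑ x, φ x ^ 2 - 2 * ∑ x, φ x * φ (x * g) := by
    rw [Finset.mul_sum, ← Finset.sum_add_distrib, ← Finset.sum_sub_distrib]
    exact Finset.sum_congr rfl fun _ _ => by ring
  rw [h, sum_comp_mul_right (fun x => φ x ^ 2), autocorr]; ring

/-- The difference of the two sides is half of `‖φ(· g) - φ‖²`. This defect measures below how far
`g` is from being a period of `φ`. -/
lemma autocorr_le (φ : G → ℝ) (g : G) : autocorr φ g ≤ ∑ x, φ x ^ 2 := by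
  have := sum_sq_sub_eq φ g
  have h : 0 ≤ ∑ x, (φ (x * g) - φ x) ^ 2 := Finset.sum_nonneg fun _ _ => sq_nonneg _
  linarith

/-- Triangle inequality for the translates of `φ`, squared by `(a + b)² ≤ 2a² + 2b²`: products of
almost-periods are almost-periods. -/
lemma autocorr_mul (φ : G → ℝ) (g h : G) :
    ∑ x, φ x ^ 2 - autocorr φ (g * h) ≤
      2 * (∑ x, φ x ^ 2 - autocorr φ g) + 2 * (∑ x, φ x ^ 2 - autocorr φ h) := by
  have h1 := sum_sq_sub_eq φ (g * h)
  have h2 := sum_sq_sub_eq φ g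
  have h3 := sum_sq_sub_eq φ h
  rw [← sum_comp_mul_right _ g] at h3
  have : ∑ x, (φ (x * (g * h)) - φ x) ^ 2 ≤
      ∑ x, (2 * (φ (x * g * h) - φ (x * g)) ^ 2 + 2 * (φ (x * g) - φ x) ^ 2) :=
    Finset.sum_le_sum fun x _ => by
      rw [← mul_assoc]
      nlinarith [sq_nonneg ((φ (x * g * h) - φ (x * g)) - (φ (x * g) - φ x))]
  rw [Finset.sum_add_distrib, ← Finset.mul_sum, ← Finset.mul_sum] at this
  linarith

lemma sum_autocorr (φ : G → ℝ) : ∑ g, autocorr φ g = (∑ x, φ x) ^ 2 := by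
  simp only [autocorr]
  rw [Finset.sum_comm, sq, Finset.sum_mul]
  exact Finset.sum_congr rfl fun x _ => by rw [← Finset.mul_sum, sum_comp_mul_left]

lemma sum_sq_half_add_eq (φ : G → ℝ) (g : G) :
    ∑ x, ((φ x + φ (x * g⁻¹)) / 2) ^ 2 = (∑ x, φ x ^ 2 + autocorr φ g) / 2 := by
  have h : ∑ x, ((φ x + φ (x * g⁻¹)) / 2) ^ 2
      = (∑ x, φ x ^ 2 + ∑ x, φ (x * g⁻¹) ^ 2 + 2 * ∑ x, φ x * φ (x * g⁻¹)) / 4 := by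
    rw [Finset.mul_sum, ← Finset.sum_add_distrib, ← Finset.sum_add_distrib, Finset.sum_div]
    exact Finset.sum_congr rfl fun _ _ => by ring
  rw [h, sum_comp_mul_right (fun x => φ x ^ 2), ← autocorr_inv, autocorr]; ring

lemma sum_sq_cubeMass_append (l : List G) (g : G) :
    ∑ x, cubeMass (l ++ [g]) x ^ 2 =
      (∑ x, cubeMass l x ^ 2 + autocorr (cubeMass l) g) / 2 := by
  simp only [cubeMass_append_singleton, sum_sq_half_add_eq]

open Classical in
lemma cubeAvg_single (l : List G) (g x : G) :
    cubeAvg l (Pi.single g 1) x = cubeMass l (x⁻¹ * g) := by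
  rw [cubeAvg_eq_sum, Finset.sum_eq_single (x⁻¹ * g)]
  · simp
  · intro z _ hz
    rw [Pi.single_eq_of_ne, mul_zero]
    exact fun h => hz (by rw [← h]; group)
  · simp

/-- Adjointness applied to point masses at `1` and `g`; a lower bound on the autocorrelation thus
becomes a lower bound on the mass function of `W`. -/
lemma cubeMass_invRev_append (l : List G) (g : G) :
    cubeMass (invRev l ++ l) g = autocorr (cubeMass l) g := by
  classical
  have h1 := sum_mul_cubeAvg_invRev l (Pi.single (1 : G) 1) (cubeAvg l (Pi.single g 1))
  rw [← cubeAvg_append, Finset.sum_eq_single (1 : G)] at h1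
  · simp only [cubeAvg_single, Pi.single_eq_same, one_mul, inv_one, mul_one] at h1
    rw [h1, autocorr]
    exact Equiv.sum_comp (Equiv.inv G) fun x => cubeMass l x * cubeMass l (x * g)
  · intro b _ hb; simp [hb]
  · simp

/-- The averaging operator of `l` has a spectral gap on the functions of mean zero. -/
def HasGap (l : List G) : Prop :=
  ∀ φ : G → ℝ, ∑ x, φ x = 0 → ∑ x, cubeAvg l φ x ^ 2 ≤ 1 / 2 * ∑ x, φ x ^ 2

/-- Extending a cube on either side averages or composes with contractions that preserve mean zero,
so a gap, once reached, is never lost. -/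
lemma HasGap.cons {l : List G} (h : HasGap l) (g : G) : HasGap (g :: l) := fun φ hφ =>
  (sum_sq_half_add_le _ _ (sum_comp_mul_right (fun x => cubeAvg l φ x ^ 2) g)).trans (h φ hφ)

lemma HasGap.append {l : List G} (h : HasGap l) (l' : List G) : HasGap (l ++ l') := by
  intro φ hφ
  rw [cubeAvg_append]
  have := h (cubeAvg l' φ) ((sum_cubeAvg l' φ).trans hφ)
  linarith [sum_sq_cubeAvg_le l' φ]

lemma sum_mul_cubeAvg_eq (w : List G) (φ : G → ℝ) :
    ∑ x, φ x * cubeAvg w φ x = ∑ g, cubeMass w g * autocorr φ g := by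
  simp only [cubeAvg_eq_sum, autocorr, Finset.mul_sum]
  rw [Finset.sum_comm]
  exact Finset.sum_congr rfl fun _ _ => Finset.sum_congr rfl fun _ _ => by ring

lemma one_le_card_mul_sum_sq (l : List G) :
    1 ≤ (Fintype.card G : ℝ) * ∑ x, cubeMass l x ^ 2 := by
  have := sq_sum_le_card_mul_sum_sq (s := Finset.univ) (f := cubeMass l)
  rwa [sum_cubeMass, one_pow] at this

/-- A Doeblin minorization: `W` has mass at least half the uniform one at every point. The uniform
part annihilates functions of mean zero, and the remaining mass `1 / 2` bounds `⟨φ, T* T φ⟩ = ‖T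
φ‖²`. -/
lemma hasGap_of_autocorr (l : List G)
    (h : ∀ g, 1 / 2 * ∑ x, cubeMass l x ^ 2 ≤ autocorr (cubeMass l) g) : HasGap l := by
  intro φ hφ
  have hc : (0 : ℝ) < Fintype.card G := by exact_mod_cast Fintype.card_pos
  set c : ℝ := 1 / (2 * Fintype.card G) with hcdef
  have hW : ∀ g, c ≤ cubeMass (invRev l ++ l) g := fun g => by
    rw [cubeMass_invRev_append]
    refine le_trans ?_ (h g)
    have := one_le_card_mul_sum_sq l
    rw [hcdef, div_le_iff₀ (by positivity)]
    linarith
  rw [← sum_mul_cubeAvg_invRev_append, sum_mul_cubeAvg_eq]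
  have h0 : ∑ g, autocorr φ g = 0 := by rw [sum_autocorr, hφ]; norm_num
  calc ∑ g, cubeMass (invRev l ++ l) g * autocorr φ g
      = ∑ g, (cubeMass (invRev l ++ l) g - c) * autocorr φ g := by
        simp only [sub_mul, Finset.sum_sub_distrib, ← Finset.mul_sum, h0]; ring
    _ ≤ ∑ g, (cubeMass (invRev l ++ l) g - c) * ∑ x, φ x ^ 2 :=
        Finset.sum_le_sum fun g _ =>
          mul_le_mul_of_nonneg_left (autocorr_le φ g) (sub_nonneg.2 (hW g))
    _ = 1 / 2 * ∑ x, φ x ^ 2 := by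
        rw [← Finset.sum_mul, Finset.sum_sub_distrib, sum_cubeMass, Finset.sum_const,
          Finset.card_univ, nsmul_eq_mul, hcdef]
        congr 1; field_simp; norm_num

end Cube

/-! ### The growth dichotomy and the distance to uniform. -/

section Growth

variable {G : Type*} [Group G] [Fintype G]

open Pointwise in
/-- If neither a draw from the cube of `l` nor a random subproduct on the generators `S` is likely
to decrease the `L²` norm of the cube, then the cube is almost uniform on an approximate subgroup
that contains most of the random subproducts on `S`, hence on `G`. -/
lemma hasGap_of_cubeAvg_autocorr (l S : List G)
    (hS : ∀ K : Subgroup G, K ≠ ⊤ → ∃ g ∈ S, g ∉ K)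
    (h₁ : (1 - 1 / 10000) * ∑ x, cubeMass l x ^ 2 ≤ cubeAvg l (autocorr (cubeMass l)) 1)
    (h₂ : (1 - 1 / 10000) * ∑ x, cubeMass l x ^ 2 ≤ cubeAvg S (autocorr (cubeMass l)) 1) :
    HasGap l := by
  classical
  set m := cubeMass l with hm
  set N := ∑ x, m x ^ 2 with hN
  have hNpos : 0 < N := by
    have := one_le_card_mul_sum_sq l
    have h0 : 0 ≤ N := Finset.sum_nonneg fun _ _ => sq_nonneg _
    rcases h0.lt_or_eq with h | h
    · exact h
    · rw [← hm, ← hN, ← h] at this; norm_num at this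
  have defect : ∀ T : List G, (1 - 1 / 10000) * N ≤ cubeAvg T (autocorr m) 1 →
      ∑ g, cubeMass T g * (N - autocorr m g) ≤ N / 10000 := fun T hT => by
    simp only [mul_sub, Finset.sum_sub_distrib, ← Finset.sum_mul, sum_cubeMass]
    rw [cubeAvg_eq_sum] at hT
    simp only [one_mul] at hT ⊢
    linarith
  have hD : ∀ g, 0 ≤ N - autocorr m g := fun g => sub_nonneg.2 (autocorr_le m g)
  set A : Finset G := {g | N - autocorr m g ≤ N / 100} with hA
  have memA : ∀ g, g ∈ A ↔ N - autocorr m g ≤ N / 100 := fun g => by simp [hA]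
  have hA1 : (1 : G) ∈ A := by
    have : autocorr m 1 = N := by simp [autocorr, hN, sq]
    rw [memA, this]; linarith
  -- Markov: the mean defect is at most `N / 10000`, the threshold of `A` is `N / 100`.
  have hmA : 99 / 100 ≤ ∑ g ∈ A, m g := by
    have h3 : ∑ g ∈ Aᶜ, m g * (N / 100) ≤ ∑ g, m g * (N - autocorr m g) :=
      (Finset.sum_le_sum fun g hg => mul_le_mul_of_nonneg_left
        (not_le.1 fun h => (Finset.mem_compl.1 hg) ((memA g).2 h)).le
          (cubeMass_nonneg l g)).trans
        (Finset.sum_le_univ_sum_of_nonneg fun g => mul_nonneg (cubeMass_nonneg l g) (hD g))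
    have h4 := Finset.sum_add_sum_compl A m
    rw [hm, sum_cubeMass, ← hm] at h4
    rw [← Finset.sum_mul] at h3
    have h5 := h3.trans (defect l h₁)
    have : ∑ g ∈ Aᶜ, m g ≤ 1 / 100 := by
      by_contra! h; nlinarith
    linarith
  have hcardA : (99 / 100 : ℝ) ^ 2 ≤ A.card * N := by
    have h3 := sq_sum_le_card_mul_sum_sq (s := A) (f := m)
    have h4 : ∑ g ∈ A, m g ^ 2 ≤ N := Finset.sum_le_univ_sum_of_nonneg fun _ => sq_nonneg _
    calc (99 / 100 : ℝ) ^ 2 ≤ (∑ g ∈ A, m g) ^ 2 := by gcongr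
      _ ≤ A.card * ∑ g ∈ A, m g ^ 2 := h3
      _ ≤ A.card * N := by gcongr
  have near : ∀ g h, g ∈ A → h ∈ A → 96 / 100 * N ≤ autocorr m (g * h) := fun g h hg hh => by
    have := autocorr_mul m g h
    rw [← hN] at this
    linarith [(memA g).1 hg, (memA h).1 hh]
  have hpos : ∀ g, 0 ≤ autocorr m g := fun g =>
    Finset.sum_nonneg fun x _ => mul_nonneg (cubeMass_nonneg l x) (cubeMass_nonneg l _)
  have hcardAA : (A * A).card * (96 / 100 * N) ≤ 1 := by
    have h3 : ∑ g ∈ A * A, 96 / 100 * N ≤ ∑ g, autocorr m g :=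
      (Finset.sum_le_sum fun g hg => by
        obtain ⟨a, ha, b, hb, rfl⟩ := Finset.mem_mul.1 hg
        exact near a b ha hb).trans (Finset.sum_le_univ_sum_of_nonneg hpos)
    rw [sum_autocorr, hm, sum_cubeMass, Finset.sum_const, nsmul_eq_mul] at h3
    simpa using h3
  -- The ratio is at most `1 / (0.96 * 0.99²) < 1.07`, well within the `3 / 2` needed for `A⁻¹ * A`
  -- to be a subgroup.
  have hdoubling : ((A * A).card : ℚ) < 3 / 2 * A.card := by
    have : ((A * A).card : ℝ) < 3 / 2 * A.card := by
      by_contra! h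
      nlinarith
    exact_mod_cast (by push_cast; exact this :
      (((A * A).card : ℚ) : ℝ) < ((3 / 2 * A.card : ℚ) : ℝ))
  have hK := Finset.invMulSubgroup_eq_inv_mul A hdoubling
  set K := Finset.invMulSubgroup A hdoubling
  have hAK : ∀ g ∈ A, g ∈ K := fun g hg => by
    rw [← SetLike.mem_coe, hK]
    exact ⟨1, by simpa using hA1, g, hg, one_mul g⟩
  have hKnear : ∀ g ∈ K, 1 / 2 * N ≤ autocorr m g := fun g hg => by
    rw [← SetLike.mem_coe, hK] at hg
    obtain ⟨a, ha, b, hb, rfl⟩ := hg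
    -- `A` is symmetric, so the bound for products of two elements of `A` covers `A⁻¹ * A`.
    have ha' : a ∈ A := by
      rw [memA, ← autocorr_inv, ← memA]; simpa using ha
    exact le_trans (by linarith) (near a b ha' hb)
  by_cases htop : K = ⊤
  · exact hasGap_of_autocorr l fun g => hKnear g (htop ▸ Subgroup.mem_top g)
  -- Elements outside `K` have defect above `N / 100` and are hit with probability at least `1 / 2`;
  -- a mean defect of `N / 200` contradicts `h₂`.
  · exfalso
    have h3 := cubeAvg_indicator_subgroup_le K S (hS K htop) 1
    rw [cubeAvg_eq_sum] at h3
    have h4 : ∑ g, cubeMass S g * (N / 100 * (1 - (K : Set G).indicator 1 (1 * g))) ≤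
        ∑ g, cubeMass S g * (N - autocorr m g) :=
      Finset.sum_le_sum fun g _ => mul_le_mul_of_nonneg_left (by
        rw [one_mul]
        by_cases hg : g ∈ K
        · simpa [Set.indicator, hg] using autocorr_le m g
        · have : N / 100 < N - autocorr m g :=
            not_le.1 fun h => hg (hAK g ((memA g).2 h))
          simpa [Set.indicator, hg] using this.le) (cubeMass_nonneg S g)
    have h5 : ∑ g, cubeMass S g * (N / 100 * (1 - (K : Set G).indicator 1 (1 * g))) =
        N / 100 * (1 - ∑ g, cubeMass S g * (K : Set G).indicator 1 (1 * g)) := by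
      rw [← sum_cubeMass S, ← Finset.sum_sub_distrib, Finset.mul_sum]
      refine Finset.sum_congr rfl fun g _ => ?_
      rw [sum_cubeMass S]; ring
    rw [h5] at h4
    have h6 := h4.trans (defect S h₂)
    nlinarith

/-- The distance of the cube of a list from the uniform distribution. -/
noncomputable def cubeDist (l : List G) : ℝ := ∑ x, (cubeMass l x - 1 / Fintype.card G) ^ 2

lemma cubeDist_nonneg (l : List G) : 0 ≤ cubeDist l := Finset.sum_nonneg fun _ _ => sq_nonneg _

lemma sum_cubeMass_sub (l : List G) : ∑ x, (cubeMass l x - 1 / (Fintype.card G : ℝ)) = 0 := by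
  rw [Finset.sum_sub_distrib, sum_cubeMass, Finset.sum_const, Finset.card_univ, nsmul_eq_mul,
    mul_one_div_cancel (by exact_mod_cast Fintype.card_ne_zero), sub_self]

lemma cubeDist_le_one (l : List G) : cubeDist l ≤ 1 := by
  have h0 := sum_cubeMass_sub l
  have hle : ∀ x, cubeMass l x ≤ 1 := fun x => by
    rw [← sum_cubeMass l]
    exact Finset.single_le_sum (fun y _ => cubeMass_nonneg l y) (Finset.mem_univ x)
  calc cubeDist l ≤ ∑ x, (cubeMass l x -
          2 * (1 / Fintype.card G) * (cubeMass l x - 1 / Fintype.card G)) :=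
        Finset.sum_le_sum fun x _ => by
          -- With `u = 1 / |G|`, `(m - u)² = m² - 2u(m - u) - u²` and `m² ≤ m`.
          nlinarith [hle x, cubeMass_nonneg l x, sq_nonneg (1 / (Fintype.card G : ℝ))]
    _ = 1 := by rw [Finset.sum_sub_distrib, ← Finset.mul_sum, h0, sum_cubeMass]; ring

lemma cubeDist_append (l : List G) (g : G) :
    cubeDist (l ++ [g]) =
      (cubeDist l + autocorr (fun x => cubeMass l x - 1 / Fintype.card G) g) / 2 := by
  rw [cubeDist, cubeDist, ← sum_sq_half_add_eq]
  refine Finset.sum_congr rfl fun x _ => ?_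
  rw [cubeMass_append_singleton]; ring

/-- If `h` has a spectral gap and `g` is drawn from the cube of `invRev h ++ h`, then appending `g`
brings a cube closer to the uniform distribution on average. -/
lemma HasGap.cubeAvg_cubeDist_append_le {h : List G} (hh : HasGap h) (l : List G) :
    cubeAvg (invRev h ++ h) (fun g => cubeDist (l ++ [g])) 1 ≤ 3 / 4 * cubeDist l := by
  have h1 := hh _ (sum_cubeMass_sub l)
  rw [← sum_mul_cubeAvg_invRev_append, sum_mul_cubeAvg_eq] at h1
  rw [cubeAvg_eq_sum]
  simp only [one_mul, cubeDist_append, mul_div_assoc', mul_add, ← Finset.sum_div,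
    Finset.sum_add_distrib, ← Finset.sum_mul, sum_cubeMass]
  rw [cubeDist] at *
  linarith

lemma abs_cubeMass_sub_le_of_cubeDist_le {l : List G} {c : ℝ} (hc : 0 ≤ c)
    (h : cubeDist l ≤ c ^ 2) (x : G) : |cubeMass l x - 1 / Fintype.card G| ≤ c := by
  refine abs_le_of_sq_le_sq (le_trans ?_ h) hc
  exact Finset.single_le_sum (f := fun x => (cubeMass l x - 1 / (Fintype.card G : ℝ)) ^ 2)
    (fun y _ => sq_nonneg _) (Finset.mem_univ x)

lemma cubeMass_append (a b : List G) (x : G) :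
    cubeMass (a ++ b) x = ∑ z, cubeMass a z * cubeMass b (z⁻¹ * x) := by
  classical
  have h := cubeAvg_single (a ++ b) x 1
  rw [inv_one, one_mul, cubeAvg_append, cubeAvg_eq_sum] at h
  simp only [cubeAvg_single, one_mul] at h
  exact h.symm

/-- The deviation from uniform of a convolution is the convolution of the deviations, as each
deviation has sum zero; its `|G|` terms are each at most `αβ / |G|²`. -/
lemma abs_cubeMass_append_sub_le {a b : List G} {α β : ℝ} (hα : 0 ≤ α)
    (ha : ∀ x, |cubeMass a x - 1 / Fintype.card G| ≤ α / Fintype.card G)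
    (hb : ∀ x, |cubeMass b x - 1 / Fintype.card G| ≤ β / Fintype.card G) (x : G) :
    |cubeMass (a ++ b) x - 1 / Fintype.card G| ≤ α * β / Fintype.card G := by
  have hc : (0 : ℝ) < Fintype.card G := by exact_mod_cast Fintype.card_pos
  set c : ℝ := (Fintype.card G : ℝ)
  have h : cubeMass (a ++ b) x - 1 / c =
      ∑ z, (cubeMass a z - 1 / c) * (cubeMass b (z⁻¹ * x) - 1 / c) := by
    have h1 : ∑ z, cubeMass b (z⁻¹ * x) = 1 := by
      rw [← sum_cubeMass b, ← sum_comp_mul_right (cubeMass b) x]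
      exact Equiv.sum_comp (Equiv.inv G) fun z => cubeMass b (z * x)
    have h2 : ∑ x, (cubeMass a x - 1 / c) = 0 := sum_cubeMass_sub a
    rw [cubeMass_append]
    simp only [mul_sub, Finset.sum_sub_distrib, ← Finset.sum_mul]
    simp only [sub_mul, Finset.sum_sub_distrib, ← Finset.mul_sum, h1]
    rw [Finset.sum_sub_distrib] at h2
    linear_combination (1 / c) * h2
  rw [h]
  calc _ ≤ ∑ z, |(cubeMass a z - 1 / c) * (cubeMass b (z⁻¹ * x) - 1 / c)| :=
        Finset.abs_sum_le_sum_abs _ _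
    _ ≤ ∑ z : G, α / c * (β / c) := Finset.sum_le_sum fun z _ => by
        rw [abs_mul]
        exact mul_le_mul (ha z) (hb _) (abs_nonneg _) (by positivity)
    _ = α * β / c := by
        rw [Finset.sum_const, Finset.card_univ, nsmul_eq_mul]
        simp only [c]; field_simp

lemma abs_cubeMass_flatten_replicate_sub_le {u : List G} {γ : ℝ} (hγ : 0 ≤ γ)
    (hu : ∀ x, |cubeMass u x - 1 / Fintype.card G| ≤ γ / Fintype.card G) {k : ℕ} (hk : 1 ≤ k) :
    ∀ x, |cubeMass (List.replicate k u).flatten x - 1 / Fintype.card G| ≤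
      γ ^ k / Fintype.card G := by
  induction k, hk using Nat.le_induction with
  | base => simpa using hu
  | succ k _ ih =>
    rw [List.replicate_succ, List.flatten_cons, pow_succ']
    exact abs_cubeMass_append_sub_le hγ hu ih

end Growth

/-! ### Programs: expectations of their results. -/

namespace BlackBoxGroup

variable {G : Type*} [Group G] (B : BlackBoxGroup G) {α β : Type}

section Expectation

/-- The expectation of a function of the value returned by a program. -/
noncomputable def expect : BBProg B.codes α → (α → ℝ) → ℝ
  | .ret a, F => F a
  | .one k, F => expect (k B.one) F
  | .mul x y k, F => expect (k (B.mul x y)) F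
  | .inv x k, F => expect (k (B.inv x)) F
  | .isOne x k, F => expect (k (B.isOne x)) F
  | .rand _ μ k, F => ∑ i, (μ i).toReal * expect (k i) F

lemma expect_bind (P : BBProg B.codes α) (f : α → BBProg B.codes β) (F : β → ℝ) :
    B.expect (P.bind f) F = B.expect P fun a => B.expect (f a) F := by
  induction P with
  | ret a => rfl
  | one k ih | mul x y k ih | inv x k ih | isOne x k ih => exact ih _
  | rand n μ k ih => simp only [BBProg.bind, expect, ih]

lemma expect_mono (P : BBProg B.codes α) {F F' : α → ℝ} (h : ∀ a, F a ≤ F' a) :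
    B.expect P F ≤ B.expect P F' := by
  induction P with
  | ret a => exact h a
  | one k ih | mul x y k ih | inv x k ih | isOne x k ih => exact ih _
  | rand n μ k ih =>
    exact Finset.sum_le_sum fun i _ => mul_le_mul_of_nonneg_left (ih i) ENNReal.toReal_nonneg

lemma _root_.PMF.sum_toReal {n : ℕ} (μ : PMF (Fin n)) : ∑ i, (μ i).toReal = 1 := by
  rw [← ENNReal.toReal_sum fun i _ => μ.apply_ne_top i, ← tsum_fintype (L := .unconditional _),
    μ.tsum_coe, ENNReal.toReal_one]

lemma expect_affine (P : BBProg B.codes α) (F : α → ℝ) (a b : ℝ) :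
    B.expect P (fun o => a + b * F o) = a + b * B.expect P F := by
  induction P with
  | ret a => rfl
  | one k ih | mul x y k ih | inv x k ih | isOne x k ih => exact ih _
  | rand n μ k ih =>
    simp only [expect, ih, mul_add, Finset.sum_add_distrib, ← Finset.sum_mul, μ.sum_toReal,
      one_mul, Finset.mul_sum]
    congr 1
    exact Finset.sum_congr rfl fun _ _ => by ring

lemma toOuterMeasure_run (P : BBProg B.codes α) (Q : Set α) :
    (B.run P).toOuterMeasure {o | o.1 ∈ Q} = ENNReal.ofReal (B.expect P (Q.indicator 1)) := by
  induction P with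
  | ret a =>
    rw [run, PMF.toOuterMeasure_pure_apply, expect]
    by_cases h : a ∈ Q <;> simp [h]
  | one k ih => exact ih _
  | mul x y k ih | inv x k ih | isOne x k ih =>
    rw [run, PMF.toOuterMeasure_map_apply]; exact ih _
  | rand n μ k ih =>
    have h0 : ∀ i, 0 ≤ B.expect (k i) (Q.indicator 1) := fun i => by
      -- With both coefficients zero this says that the zero function has expectation zero.
      have h := B.expect_affine (k i) (Q.indicator 1) 0 0
      rw [zero_mul, add_zero] at h
      rw [← h]
      refine B.expect_mono _ fun a => ?_
      rw [zero_mul, add_zero]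
      exact Set.indicator_nonneg (fun _ _ => zero_le_one) a
    rw [run, PMF.toOuterMeasure_bind_apply, expect, tsum_fintype,
      ENNReal.ofReal_sum_of_nonneg fun i _ => mul_nonneg ENNReal.toReal_nonneg (h0 i)]
    refine Finset.sum_congr rfl fun i _ => ?_
    rw [ENNReal.ofReal_mul ENNReal.toReal_nonneg, ENNReal.ofReal_toReal (μ.apply_ne_top i), ih]

lemma law_apply (P : BBProg B.codes B.codes) (g : G) :
    B.law P g = ENNReal.ofReal (B.expect P fun x => ({g} : Set G).indicator 1 (B.val x)) := by
  rw [law, ← PMF.toOuterMeasure_apply_singleton, PMF.toOuterMeasure_map_apply]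
  exact B.toOuterMeasure_run P (B.val ⁻¹' {g})

lemma expect_subproductFrom (acc : B.codes) (l : List B.codes) (φ : G → ℝ) :
    B.expect (BBProg.subproductFrom acc l) (fun x => φ (B.val x)) =
      cubeAvg (l.map B.val) φ (B.val acc) := by
  induction l generalizing acc with
  | nil => rfl
  | cons g l ih =>
    simp only [BBProg.subproductFrom, expect, Fin.sum_univ_two, List.map_cons, cubeAvg_cons,
      PMF.uniformOfFintype_apply, Fintype.card_fin, if_true, one_ne_zero, if_false, ih, B.val_mul]
    norm_num
    ring

lemma expect_randomSubproduct (l : List B.codes) (φ : G → ℝ) :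
    B.expect (BBProg.randomSubproduct l) (fun x => φ (B.val x)) =
      cubeAvg (l.map B.val) φ 1 := by
  rw [BBProg.randomSubproduct, expect, expect_subproductFrom, B.val_one]

lemma law_draw_toReal [Finite G] (k : ℕ) (u : List B.codes) (g : G) :
    (B.law (BBProg.draw k u) g).toReal =
      cubeMass (List.replicate k (u.map B.val)).flatten g := by
  classical
  have := Fintype.ofFinite G
  have h : ({g} : Set G).indicator (1 : G → ℝ) = Pi.single g 1 := by
    ext x; by_cases hx : x = g <;> simp [hx]
  rw [law_apply, BBProg.draw, expect_randomSubproduct, h, cubeAvg_single, inv_one, one_mul,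
    ENNReal.toReal_ofReal (cubeMass_nonneg _ _), List.map_flatten, List.map_replicate]

/-- The program makes no random choice, but codes are not unique, so its output is described only
through its values in `G`. -/
lemma expect_invReverse_le (l : List B.codes) (F : List B.codes → ℝ) (c : ℝ)
    (h : ∀ l' : List B.codes, l'.map B.val = invRev (l.map B.val) → F l' ≤ c) :
    B.expect (BBProg.invReverse l) F ≤ c := by
  induction l generalizing F with
  | nil => exact h [] rfl
  | cons g l ih =>
    simp only [BBProg.invReverse, expect, expect_bind]
    exact ih _ fun l' hl' => h _ (by simp [invRev, hl', B.val_inv])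

lemma expect_drawMany_le [Fintype G] {h : List G} (hh : HasGap h) (w : List B.codes)
    (hw : w.map B.val = invRev h ++ h) (s : ℕ) :
    B.expect (BBProg.drawMany w s) (fun ps => cubeDist ((w ++ ps).map B.val)) ≤
      (3 / 4) ^ s := by
  induction s with
  | zero => simpa [BBProg.drawMany, expect] using cubeDist_le_one _
  | succ s ih =>
    rw [BBProg.drawMany, expect_bind]
    calc _ ≤ B.expect (BBProg.drawMany w s)
          (fun ps => 0 + 3 / 4 * cubeDist ((w ++ ps).map B.val)) :=
          B.expect_mono _ fun ps => by
            have := hh.cubeAvg_cubeDist_append_le ((w ++ ps).map B.val)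
            rw [← hw, ← expect_randomSubproduct] at this
            rw [expect_bind, zero_add]
            simpa [expect] using this
      _ ≤ (3 / 4) ^ (s + 1) := by
          rw [expect_affine, zero_add, pow_succ']
          gcongr

open Classical in
/-- The squared `L²` norm of the cube of a list without a spectral gap. -/
noncomputable def _root_.cubePotential [Fintype G] (l : List G) : ℝ :=
  if HasGap l then 0 else ∑ x, cubeMass l x ^ 2

lemma _root_.cubePotential_le [Fintype G] (l : List G) :
    cubePotential l ≤ ∑ x, cubeMass l x ^ 2 := by
  rw [cubePotential]
  split_ifs
  · exact Finset.sum_nonneg fun _ _ => sq_nonneg _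
  · rfl

lemma _root_.cubeAvg_le [Fintype G] (l : List G) {φ : G → ℝ} {c : ℝ} (h : ∀ x, φ x ≤ c) (x : G) :
    cubeAvg l φ x ≤ c := by
  rw [cubeAvg_eq_sum, ← one_mul c, ← sum_cubeMass l, Finset.sum_mul]
  exact Finset.sum_le_sum fun z _ => mul_le_mul_of_nonneg_left (h _) (cubeMass_nonneg l z)

/-- The potential is at most the squared norm, whose change on appending `g` is exact; a new gap can
only help. -/
lemma _root_.cubeAvg_cubePotential_append_le [Fintype G] (T l : List G) :
    cubeAvg T (fun g => cubePotential (l ++ [g])) 1 ≤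
      (∑ x, cubeMass l x ^ 2 + cubeAvg T (autocorr (cubeMass l)) 1) / 2 := by
  rw [cubeAvg_eq_sum, cubeAvg_eq_sum]
  calc _ ≤ ∑ z, cubeMass T z * ((∑ x, cubeMass l x ^ 2 + autocorr (cubeMass l) (1 * z)) / 2) :=
        Finset.sum_le_sum fun z _ => mul_le_mul_of_nonneg_left
          ((cubePotential_le _).trans (by rw [one_mul, sum_sq_cubeMass_append]))
          (cubeMass_nonneg T z)
    _ = _ := by
        simp only [mul_div_assoc', mul_add, ← Finset.sum_div, Finset.sum_add_distrib,
          ← Finset.sum_mul, sum_cubeMass, one_mul]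

/-- Without a gap no branch raises the mean potential, and `hasGap_of_cubeAvg_autocorr` forces a
loss of `N / 10000` in the mean autocorrelation of branch `0` or `2`. The factor `1 / 2` in the norm
formula makes this `N / 20000`, weighted by the probability of that branch. -/
lemma expect_fibonacciStep_le [Fintype G] (p : PMF (Fin 3)) {δ : ℝ}
    (h0 : δ ≤ (p 0).toReal / 20000) (h2 : δ ≤ (p 2).toReal / 20000) (S hs : List B.codes)
    (hS : Subgroup.closure (B.val '' {x | x ∈ S}) = ⊤) :
    B.expect (BBProg.fibonacciStep p S hs) (fun l => cubePotential (l.map B.val)) ≤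
      (1 - δ) * cubePotential (hs.map B.val) := by
  have e : B.expect (BBProg.fibonacciStep p S hs) (fun l => cubePotential (l.map B.val)) =
      (p 0).toReal * cubeAvg (hs.map B.val) (fun g => cubePotential (hs.map B.val ++ [g])) 1 +
      (p 1).toReal * cubeAvg (hs.map B.val) (fun g => cubePotential (g :: hs.map B.val)) 1 +
      (p 2).toReal * cubeAvg (S.map B.val) (fun g => cubePotential (hs.map B.val ++ [g])) 1 := by
    rw [← expect_randomSubproduct, ← expect_randomSubproduct, ← expect_randomSubproduct]
    simp [BBProg.fibonacciStep, expect, expect_bind, Fin.sum_univ_three]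
  rw [e]
  set l := hs.map B.val
  have hp0 : 0 ≤ (p 0).toReal := ENNReal.toReal_nonneg
  have hp1 : 0 ≤ (p 1).toReal := ENNReal.toReal_nonneg
  have hp2 : 0 ≤ (p 2).toReal := ENNReal.toReal_nonneg
  have hp := p.sum_toReal
  rw [Fin.sum_univ_three] at hp
  by_cases hl : HasGap l
  · have h1 : ∀ T, cubeAvg T (fun g => cubePotential (l ++ [g])) 1 ≤ 0 := fun T =>
      cubeAvg_le T (fun g => by rw [cubePotential, if_pos (hl.append [g])]) 1
    have h2 : cubeAvg l (fun g => cubePotential (g :: l)) 1 ≤ 0 :=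
      cubeAvg_le l (fun g => by rw [cubePotential, if_pos (hl.cons g)]) 1
    rw [show cubePotential l = 0 from if_pos hl]
    nlinarith [mul_nonneg hp0 (neg_nonneg.2 (h1 l)), mul_nonneg hp1 (neg_nonneg.2 h2),
      mul_nonneg hp2 (neg_nonneg.2 (h1 (S.map B.val)))]
  · rw [show cubePotential l = ∑ x, cubeMass l x ^ 2 from if_neg hl]
    set N := ∑ x, cubeMass l x ^ 2 with hN
    have hN0 : 0 ≤ N := Finset.sum_nonneg fun _ _ => sq_nonneg _
    have hδN0 := mul_le_mul_of_nonneg_right h0 hN0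
    have hδN2 := mul_le_mul_of_nonneg_right h2 hN0
    have ha : ∀ T, cubeAvg T (autocorr (cubeMass l)) 1 ≤ N := fun T =>
      cubeAvg_le T (autocorr_le (cubeMass l)) 1
    have e0 := mul_le_mul_of_nonneg_left (cubeAvg_cubePotential_append_le l l) hp0
    have e2 := mul_le_mul_of_nonneg_left
      (cubeAvg_cubePotential_append_le (S.map B.val) l) hp2
    have e1 := mul_le_mul_of_nonneg_left (cubeAvg_le l (fun g =>
      (cubePotential_le (g :: l)).trans (sum_sq_cubeMass_cons_le g l)) 1) hp1
    rw [← hN] at e0 e1 e2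
    have a0 := mul_le_mul_of_nonneg_left (ha l) hp0
    have a2 := mul_le_mul_of_nonneg_left (ha (S.map B.val)) hp2
    have hpN : (p 0).toReal * N + (p 1).toReal * N + (p 2).toReal * N = N := by
      rw [← add_mul, ← add_mul, hp, one_mul]
    by_cases c0 : (1 - 1 / 10000) * N ≤ cubeAvg l (autocorr (cubeMass l)) 1
    · by_cases c2 : (1 - 1 / 10000) * N ≤ cubeAvg (S.map B.val) (autocorr (cubeMass l)) 1
      · refine absurd (hasGap_of_cubeAvg_autocorr l (S.map B.val) (fun K hK => ?_) c0 c2) hl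
        by_contra! h
        refine hK (top_le_iff.1 (hS ▸ (Subgroup.closure_le K).2 ?_))
        rintro _ ⟨x, hx, rfl⟩
        exact h _ (List.mem_map_of_mem hx)
      · have := mul_le_mul_of_nonneg_left (not_le.1 c2).le hp2
        linarith
    · have := mul_le_mul_of_nonneg_left (not_le.1 c0).le hp0
      linarith

lemma expect_fibonacciCube_le [Fintype G] (p : PMF (Fin 3)) {δ : ℝ}
    (h0 : δ ≤ (p 0).toReal / 20000) (h2 : δ ≤ (p 2).toReal / 20000) (hδ : δ ≤ 1)
    (S : List B.codes) (hS : Subgroup.closure (B.val '' {x | x ∈ S}) = ⊤) (t : ℕ) :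
    B.expect (BBProg.fibonacciCube p S t) (fun l => cubePotential (l.map B.val)) ≤
      (1 - δ) ^ t := by
  induction t with
  | zero =>
    refine (cubePotential_le _).trans ?_
    classical simp [cubeMass]
  | succ t ih =>
    rw [BBProg.fibonacciCube, expect_bind]
    calc _ ≤ B.expect (BBProg.fibonacciCube p S t)
          (fun l => 0 + (1 - δ) * cubePotential (l.map B.val)) :=
          B.expect_mono _ fun hs => by
            rw [zero_add]; exact B.expect_fibonacciStep_le p h0 h2 S hs hS
      _ ≤ (1 - δ) ^ (t + 1) := by
          rw [expect_affine, zero_add, pow_succ']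
          exact mul_le_mul_of_nonneg_left ih (by linarith)

/-- If the gap is present, the draws from `W` give `(3 / 4) ^ s`. If not, the distance is at most
`1`, which is at most `|G|` times the potential. -/
lemma expect_construct_le [Fintype G] (p : PMF (Fin 3)) {δ : ℝ}
    (h0 : δ ≤ (p 0).toReal / 20000) (h2 : δ ≤ (p 2).toReal / 20000) (hδ : δ ≤ 1)
    (S : List B.codes) (hS : Subgroup.closure (B.val '' {x | x ∈ S}) = ⊤) (t s : ℕ) :
    B.expect (BBProg.construct p S t s) (fun u => cubeDist (u.map B.val)) ≤
      (3 / 4) ^ s + Fintype.card G * (1 - δ) ^ t := by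
  rw [BBProg.construct, expect_bind]
  calc _ ≤ B.expect (BBProg.fibonacciCube p S t)
        (fun l => (3 / 4) ^ s + Fintype.card G * cubePotential (l.map B.val)) :=
        B.expect_mono _ fun hs => by
          rw [expect_bind]
          refine B.expect_invReverse_le hs _ _ fun hs' hhs' => ?_
          rw [expect_bind]
          simp only [expect]
          by_cases hg : HasGap (hs.map B.val)
          · rw [cubePotential, if_pos hg, mul_zero, add_zero]
            exact B.expect_drawMany_le hg _ (by rw [List.map_append, hhs']) s
          · rw [cubePotential, if_neg hg]
            have h1 : B.expect (BBProg.drawMany (hs' ++ hs) s)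
                (fun ps => cubeDist ((hs' ++ hs ++ ps).map B.val)) ≤ 1 := by
              calc _ ≤ B.expect (BBProg.drawMany (hs' ++ hs) s)
                    (fun ps => 1 + 0 * cubeDist ((hs' ++ hs ++ ps).map B.val)) :=
                    B.expect_mono _ fun ps => by
                      rw [zero_mul, add_zero]; exact cubeDist_le_one _
                _ = 1 := by rw [expect_affine, zero_mul, add_zero]
            have h2 := one_le_card_mul_sum_sq (hs.map B.val)
            have h3 : (0 : ℝ) ≤ (3 / 4) ^ s := by positivity
            linarith
    _ ≤ _ := by
        rw [expect_affine]
        gcongr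
        exact B.expect_fibonacciCube_le p h0 h2 hδ S hS t

end Expectation

/-! ### Operation counts, valid on every run. -/

section Cost

/-- Runs of a composed program split into consecutive runs with additive cost, so each bound below
follows the program's structure. -/
lemma exists_of_mem_support_run_bind {P : BBProg B.codes α} {f : α → BBProg B.codes β}
    {o : β × ℕ} (ho : o ∈ (B.run (P.bind f)).support) :
    ∃ o₁ ∈ (B.run P).support, ∃ o₂ ∈ (B.run (f o₁.1)).support, o = (o₂.1, o₁.2 + o₂.2) := by
  induction P generalizing o with
  | ret a => exact ⟨(a, 0), by simp [run], o, ho, by simp⟩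
  | one k ih => exact ih _ ho
  | mul x y k ih | inv x k ih | isOne x k ih =>
    simp only [BBProg.bind, run, PMF.support_map, Set.mem_image] at ho ⊢
    obtain ⟨o', ho', rfl⟩ := ho
    obtain ⟨o₁, h₁, o₂, h₂, rfl⟩ := ih _ ho'
    exact ⟨(o₁.1, o₁.2 + 1), ⟨o₁, h₁, rfl⟩, o₂, h₂, by simp; omega⟩
  | rand n μ k ih =>
    simp only [BBProg.bind, run, PMF.mem_support_bind_iff] at ho ⊢
    obtain ⟨i, hi, ho⟩ := ho
    obtain ⟨o₁, h₁, o₂, h₂, rfl⟩ := ih _ ho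
    exact ⟨o₁, ⟨i, hi, h₁⟩, o₂, h₂, rfl⟩

lemma cost_subproductFrom_le {acc : B.codes} {l : List B.codes} {o : B.codes × ℕ}
    (ho : o ∈ (B.run (BBProg.subproductFrom acc l)).support) : o.2 ≤ l.length := by
  induction l generalizing acc o with
  | nil =>
    simp only [BBProg.subproductFrom, run, PMF.support_pure, Set.mem_singleton_iff] at ho
    simp [ho]
  | cons g l ih =>
    simp only [BBProg.subproductFrom, run, PMF.mem_support_bind_iff] at ho
    obtain ⟨i, -, ho⟩ := ho
    split_ifs at ho
    · exact (ih ho).trans (by simp)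
    · simp only [run, PMF.support_map, Set.mem_image] at ho
      obtain ⟨o', ho', rfl⟩ := ho
      simpa using ih ho'

lemma cost_randomSubproduct_le {l : List B.codes} {o : B.codes × ℕ}
    (ho : o ∈ (B.run (BBProg.randomSubproduct l)).support) : o.2 ≤ l.length :=
  B.cost_subproductFrom_le ho

lemma cost_draw_le {k : ℕ} {u : List B.codes} {o : B.codes × ℕ}
    (ho : o ∈ (B.run (BBProg.draw k u)).support) : o.2 ≤ k * u.length := by
  simpa using B.cost_randomSubproduct_le ho

lemma eq_of_mem_support_run_ret {a : α} {o : α × ℕ}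
    (ho : o ∈ (B.run (BBProg.ret a)).support) : o = (a, 0) := by
  simpa [run] using ho

lemma cost_fibonacciStep_le {p : PMF (Fin 3)} {S hs : List B.codes} {o : List B.codes × ℕ}
    (ho : o ∈ (B.run (BBProg.fibonacciStep p S hs)).support) :
    o.1.length = hs.length + 1 ∧ o.2 ≤ hs.length + S.length := by
  simp only [BBProg.fibonacciStep, run, PMF.mem_support_bind_iff] at ho
  obtain ⟨j, -, ho⟩ := ho
  split_ifs at ho <;>
  · obtain ⟨o₁, h₁, o₂, h₂, rfl⟩ := B.exists_of_mem_support_run_bind ho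
    have := B.cost_randomSubproduct_le h₁
    rw [B.eq_of_mem_support_run_ret h₂]
    simp
    omega

lemma cost_fibonacciCube_le {p : PMF (Fin 3)} {S : List B.codes} {t : ℕ} {o : List B.codes × ℕ}
    (ho : o ∈ (B.run (BBProg.fibonacciCube p S t)).support) :
    o.1.length = t ∧ o.2 ≤ t * (t + S.length) := by
  induction t generalizing o with
  | zero => simp [B.eq_of_mem_support_run_ret ho]
  | succ t ih =>
    obtain ⟨o₁, h₁, o₂, h₂, rfl⟩ := B.exists_of_mem_support_run_bind ho
    obtain ⟨a, b⟩ := ih h₁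
    obtain ⟨c, d⟩ := B.cost_fibonacciStep_le h₂
    refine ⟨by simp [c, a], ?_⟩
    simp only
    nlinarith

lemma cost_invReverse_le {l : List B.codes} {o : List B.codes × ℕ}
    (ho : o ∈ (B.run (BBProg.invReverse l)).support) :
    o.1.length = l.length ∧ o.2 ≤ l.length := by
  induction l generalizing o with
  | nil => simp [B.eq_of_mem_support_run_ret ho]
  | cons g l ih =>
    simp only [BBProg.invReverse, run, PMF.support_map, Set.mem_image] at ho
    obtain ⟨o', ho', rfl⟩ := ho
    obtain ⟨o₁, h₁, o₂, h₂, rfl⟩ := B.exists_of_mem_support_run_bind ho'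
    rw [B.eq_of_mem_support_run_ret h₂]
    simpa using ih h₁

lemma cost_drawMany_le {w : List B.codes} {s : ℕ} {o : List B.codes × ℕ}
    (ho : o ∈ (B.run (BBProg.drawMany w s)).support) :
    o.1.length = s ∧ o.2 ≤ s * w.length := by
  induction s generalizing o with
  | zero => simp [B.eq_of_mem_support_run_ret ho]
  | succ s ih =>
    obtain ⟨o₁, h₁, o₂, h₂, rfl⟩ := B.exists_of_mem_support_run_bind ho
    obtain ⟨o₃, h₃, o₄, h₄, rfl⟩ := B.exists_of_mem_support_run_bind h₂
    obtain ⟨a, b⟩ := ih h₁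
    have := B.cost_randomSubproduct_le h₃
    rw [B.eq_of_mem_support_run_ret h₄]
    refine ⟨by simp [a], ?_⟩
    simp only
    nlinarith

lemma cost_construct_le {p : PMF (Fin 3)} {S : List B.codes} {t s : ℕ} {o : List B.codes × ℕ}
    (ho : o ∈ (B.run (BBProg.construct p S t s)).support) :
    o.1.length = 2 * t + s ∧ o.2 ≤ t * (t + S.length) + t + s * (2 * t) := by
  obtain ⟨o₁, h₁, o₂, h₂, rfl⟩ := B.exists_of_mem_support_run_bind ho
  obtain ⟨o₃, h₃, o₄, h₄, rfl⟩ := B.exists_of_mem_support_run_bind h₂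
  obtain ⟨o₅, h₅, o₆, h₆, rfl⟩ := B.exists_of_mem_support_run_bind h₄
  rw [B.eq_of_mem_support_run_ret h₆]
  obtain ⟨a₁, b₁⟩ := B.cost_fibonacciCube_le h₁
  obtain ⟨a₃, b₃⟩ := B.cost_invReverse_le h₃
  obtain ⟨a₅, b₅⟩ := B.cost_drawMany_le h₅
  rw [List.length_append, a₃, a₁, ← two_mul] at b₅
  refine ⟨by simp [a₁, a₃, a₅]; omega, ?_⟩
  simp only
  omega

end Cost

end BlackBoxGroup

/-! ### Logarithms and rounding. -/

section Logarithms

lemma pow_le_one_div_pow_of_le {q : ℝ} (hq0 : 0 < q) (hq1 : q < 1) (n : ℕ) {L : ℝ} (hL : 1 ≤ L)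
    {t : ℕ} (ht : n / -Real.log q * Real.log L ≤ t) : q ^ t ≤ 1 / L ^ n := by
  have hlog : 0 < -Real.log q := neg_pos.2 (Real.log_neg hq0 hq1)
  have hL0 : 0 < L := by linarith
  rw [div_mul_eq_mul_div, div_le_iff₀ hlog] at ht
  rw [← Real.log_le_log_iff (by positivity) (by positivity), Real.log_pow, one_div, Real.log_inv,
    Real.log_pow]
  linarith

lemma half_lt_log_natCast {L : ℕ} (hL : 2 ≤ L) : 1 / 2 < Real.log L := by
  have h1 := Real.log_two_gt_d9
  have h2 : Real.log 2 ≤ Real.log L := Real.log_le_log (by norm_num) (by exact_mod_cast hL)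
  linarith

/-- For `L ≥ 2` the rounding error is below `1 ≤ 2 log L`; for `L = 1` both sides vanish. -/
lemma natCeil_mul_log_le {τ : ℝ} (hτ : 0 < τ) {L : ℕ} (hL : 1 ≤ L) :
    (⌈τ * Real.log L⌉₊ : ℝ) ≤ (τ + 2) * Real.log L := by
  rcases hL.eq_or_lt with rfl | h
  · simp
  · have h1 := half_lt_log_natCast h
    have h2 := Nat.ceil_lt_add_one (a := τ * Real.log L) (by positivity)
    linarith

lemma natCeil_log_div_log_half_le {ε : ℝ} (h0 : 0 < ε) (h1 : ε < 1) :
    (⌈Real.log ε / Real.log (1 / 2)⌉₊ : ℝ) ≤ 2 * (1 + Real.log (1 / ε)) := by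
  have h2 := Real.log_two_gt_d9
  have h3 : 0 < Real.log (1 / ε) := Real.log_pos (by rw [lt_div_iff₀ h0]; linarith)
  have h4 : Real.log ε / Real.log (1 / 2) = Real.log (1 / ε) / Real.log 2 := by
    rw [one_div, one_div, Real.log_inv, Real.log_inv, div_neg, neg_div]
  have h5 : Real.log (1 / ε) / Real.log 2 ≤ 2 * Real.log (1 / ε) := by
    rw [div_le_iff₀ (by linarith)]; nlinarith
  rw [h4]
  have h6 := Nat.ceil_lt_add_one (a := Real.log (1 / ε) / Real.log 2) (by positivity)
  linarith

lemma half_pow_natCeil_le {ε : ℝ} (h0 : 0 < ε) :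
    (1 / 2 : ℝ) ^ ⌈Real.log ε / Real.log (1 / 2)⌉₊ ≤ ε := by
  have hlog : Real.log (1 / 2) < 0 := Real.log_neg (by norm_num) (by norm_num)
  rw [← Real.log_le_log_iff (by positivity) h0, Real.log_pow, ← div_le_iff_of_neg hlog]
  exact Nat.le_ceil _

end Logarithms

/-! ### Success probability and the main theorem. -/

/-- If the cube of `u` is close to the uniform distribution, then powers of it are `ε`-uniform. -/
lemma BlackBoxGroup.isEpsUniform_draw {G : Type*} [Group G] [Fintype G] (B : BlackBoxGroup G)
    {u : List B.codes} (hu : cubeDist (u.map B.val) ≤ (1 / 2 / (Fintype.card G : ℝ)) ^ 2)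
    {ε : ℝ} (h0 : 0 < ε) (h1 : ε < 1) :
    IsEpsUniform ε (B.law (BBProg.draw ⌈Real.log ε / Real.log (1 / 2)⌉₊ u)) := by
  intro g
  -- An empty product would be the constant `1`, so at least one factor is needed.
  have hk : 1 ≤ ⌈Real.log ε / Real.log (1 / 2)⌉₊ := Nat.ceil_pos.2
    (div_pos_of_neg_of_neg (Real.log_neg h0 h1) (Real.log_neg (by norm_num) (by norm_num)))
  rw [B.law_draw_toReal, Nat.card_eq_fintype_card]
  refine (abs_cubeMass_flatten_replicate_sub_le (by norm_num)
    (abs_cubeMass_sub_le_of_cubeDist_le (by positivity) hu) hk g).trans ?_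
  gcongr
  exact half_pow_natCeil_le h0

lemma BlackBoxGroup.le_toOuterMeasure_construct {G : Type*} [Group G] [Fintype G]
    (B : BlackBoxGroup G) (p : PMF (Fin 3)) {δ : ℝ} (hδ0 : 0 < δ)
    (h0 : δ ≤ (p 0).toReal / 20000) (h2 : δ ≤ (p 2).toReal / 20000) (hδ : δ < 1)
    (S : List B.codes) (hS : Subgroup.closure (B.val '' {x | x ∈ S}) = ⊤)
    {L : ℕ} (hL : Fintype.card G ≤ L) (κ : ℕ) {t s : ℕ}
    (ht : (κ + 6 : ℕ) / -Real.log (1 - δ) * Real.log L ≤ t)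
    (hs : (κ + 6 : ℕ) / -Real.log (3 / 4) * Real.log L ≤ s) :
    ENNReal.ofReal (1 - 1 / (L : ℝ) ^ κ) ≤
      (B.run (BBProg.construct p S t s)).toOuterMeasure
        {o | ∀ ε : ℝ, 0 < ε → ε < 1 →
          IsEpsUniform ε (B.law (BBProg.draw ⌈Real.log ε / Real.log (1 / 2)⌉₊ o.1))} := by
  have hc : 1 ≤ Fintype.card G := Fintype.card_pos
  rcases (hc.trans hL).eq_or_lt with rfl | hL2
  · simp
  have hcR : (0 : ℝ) < Fintype.card G := by exact_mod_cast hc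
  have hLR : (Fintype.card G : ℝ) ≤ L := by exact_mod_cast hL
  have hL2R : (2 : ℝ) ≤ L := by exact_mod_cast hL2
  set Q : Set (List B.codes) := {u | ∀ ε : ℝ, 0 < ε → ε < 1 →
    IsEpsUniform ε (B.law (BBProg.draw ⌈Real.log ε / Real.log (1 / 2)⌉₊ u))} with hQ
  refine le_trans (ENNReal.ofReal_le_ofReal ?_) (B.toOuterMeasure_run _ Q).ge
  -- Markov's inequality as a pointwise affine minorant of the indicator: outside `Q` the distance
  -- exceeds `1 / (4|G|²) ≥ 1 / (4L²)`.
  have hind : ∀ u : List B.codes,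
      1 + -(4 * (L : ℝ) ^ 2) * cubeDist (u.map B.val) ≤ Q.indicator 1 u := fun u => by
    by_cases hu : u ∈ Q
    · rw [Set.indicator_of_mem hu, Pi.one_apply]
      nlinarith [mul_nonneg (sq_nonneg (L : ℝ)) (cubeDist_nonneg (u.map B.val))]
    · rw [Set.indicator_of_notMem hu]
      have h1 : (1 / 2 / (Fintype.card G : ℝ)) ^ 2 < cubeDist (u.map B.val) :=
        not_le.1 fun h => hu fun ε hε hε1 => B.isEpsUniform_draw h hε hε1
      have h3 : (1 / 2 / (L : ℝ)) ^ 2 ≤ (1 / 2 / (Fintype.card G : ℝ)) ^ 2 := by gcongr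
      have h4 : 4 * (L : ℝ) ^ 2 * (1 / 2 / (L : ℝ)) ^ 2 = 1 := by field_simp; norm_num
      have h5 := mul_le_mul_of_nonneg_left (h3.trans h1.le) (by positivity : 0 ≤ 4 * (L : ℝ) ^ 2)
      linarith
  refine le_trans ?_ (B.expect_mono _ hind)
  rw [expect_affine]
  have e := B.expect_construct_le p h0 h2 hδ.le S hS t s
  have et := pow_le_one_div_pow_of_le (by linarith) (by linarith) (κ + 6) (by linarith) ht
  have es := pow_le_one_div_pow_of_le (by norm_num) (by norm_num) (κ + 6) (by linarith) hs
  have e' : B.expect (BBProg.construct p S t s) (fun u => cubeDist (u.map B.val)) ≤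
      (1 + L) * (1 / (L : ℝ) ^ (κ + 6)) := by
    refine e.trans ?_
    rw [add_mul, one_mul]
    gcongr
  -- The extra exponent `6` absorbs the Markov factor `4L²` and the factor `1 + L`, since `4(1 + L)
  -- ≤ L⁴` for `L ≥ 2`.
  have e3 : 4 * (L : ℝ) ^ 2 * ((1 + L) * (1 / (L : ℝ) ^ (κ + 6))) ≤ 1 / (L : ℝ) ^ κ := by
    rw [pow_add, show 4 * (L : ℝ) ^ 2 * ((1 + L) * (1 / ((L : ℝ) ^ κ * L ^ 6))) =
      1 / (L : ℝ) ^ κ * (4 * (1 + L) / L ^ 4) by field_simp]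
    refine mul_le_of_le_one_right (by positivity) ?_
    rw [div_le_one (by positivity)]
    have h8 : (8 : ℝ) ≤ (L : ℝ) ^ 3 := by
      calc (8 : ℝ) = 2 ^ 3 := by norm_num
        _ ≤ _ := by gcongr
    nlinarith
  have := mul_le_mul_of_nonneg_left e' (by positivity : 0 ≤ 4 * (L : ℝ) ^ 2)
  linarith

/-- Here `L` is an upper bound for `|G|` that is known to the algorithm; `L = |G|` is allowed.
The construction phase does not depend on `ε`. -/
theorem mainTheorem1 (p : PMF (Fin 3)) (hp : ∀ j, p j ≠ 0) (κ : ℕ) :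
    ∃ τ σ γ C : ℝ, 0 < τ ∧ 0 < σ ∧ 0 < γ ∧ γ < 1 ∧ 0 < C ∧
      ∀ (G : Type*) [Group G] (B : BlackBoxGroup G) (S : List B.codes),
        Subgroup.closure (B.val '' {x | x ∈ S}) = ⊤ →
        ∀ L : ℕ, Nat.card G ≤ L →
          -- every run of the construction is cheap
          (∀ o ∈ (B.run (BBProg.construct p S ⌈τ * Real.log L⌉₊ ⌈σ * Real.log L⌉₊)).support,
            (o.2 : ℝ) ≤ C * (Real.log L ^ 2 + S.length * Real.log L)) ∧
          -- every draw from every constructed random variable is cheap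
          (∀ o ∈ (B.run (BBProg.construct p S ⌈τ * Real.log L⌉₊ ⌈σ * Real.log L⌉₊)).support,
            ∀ ε : ℝ, 0 < ε → ε < 1 →
              ∀ o' ∈ (B.run (BBProg.draw ⌈Real.log ε / Real.log γ⌉₊ o.1)).support,
                (o'.2 : ℝ) ≤ C * ((1 + Real.log (1 / ε)) * Real.log L)) ∧
          -- with high probability the constructed random variables are `ε`-uniform
          ENNReal.ofReal (1 - 1 / (L : ℝ) ^ κ) ≤
            (B.run (BBProg.construct p S ⌈τ * Real.log L⌉₊ ⌈σ * Real.log L⌉₊)).toOuterMeasure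
              {o | ∀ ε : ℝ, 0 < ε → ε < 1 →
                IsEpsUniform ε (B.law (BBProg.draw ⌈Real.log ε / Real.log γ⌉₊ o.1))} := by
  have hp' : ∀ j, 0 < (p j).toReal := fun j => ENNReal.toReal_pos (hp j) (p.apply_ne_top j)
  obtain ⟨δ, hδ0, h0, h2, hδ1⟩ : ∃ δ : ℝ, 0 < δ ∧ δ ≤ (p 0).toReal / 20000 ∧
      δ ≤ (p 2).toReal / 20000 ∧ δ < 1 := by
    refine ⟨min (min ((p 0).toReal / 20000) ((p 2).toReal / 20000)) (1 / 2), ?_,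
      (min_le_left _ _).trans (min_le_left _ _), (min_le_left _ _).trans (min_le_right _ _),
      (min_le_right _ _).trans_lt (by norm_num)⟩
    have := hp' 0
    have := hp' 2
    positivity
  set τ : ℝ := (κ + 6 : ℕ) / -Real.log (1 - δ) with hτdef
  set σ : ℝ := (κ + 6 : ℕ) / -Real.log (3 / 4) with hσdef
  have hτ : 0 < τ := div_pos (by positivity)
    (neg_pos.2 (Real.log_neg (by linarith) (by linarith)))
  have hσ : 0 < σ := div_pos (by positivity)
    (neg_pos.2 (Real.log_neg (by norm_num) (by norm_num)))
  set a : ℝ := τ + 2 with ha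
  set b : ℝ := σ + 2 with hb
  have ha0 : 0 < a := by positivity
  have hb0 : 0 < b := by positivity
  -- `C` adds the coefficients for construction and for drawing. The latter comes from `k ≤ 2 (1 +
  -- log (1 / ε))` and cube length `2t + s ≤ (2a + b) log L`.
  refine ⟨τ, σ, 1 / 2, (2 * a ^ 2 + 2 * a * b + a) + 2 * (2 * a + b), hτ, hσ, by norm_num,
    by norm_num, by positivity, fun G _ B S hS L hL => ?_⟩
  have : Finite G := Finite.of_surjective B.val B.val_surjective
  have := Fintype.ofFinite G
  rw [Nat.card_eq_fintype_card] at hL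
  have hL1 : 1 ≤ L := Fintype.card_pos.trans_le hL
  have hlog : 0 ≤ Real.log L := Real.log_natCast_nonneg L
  have htle := natCeil_mul_log_le hτ hL1
  have hsle := natCeil_mul_log_le hσ hL1
  have htge := Nat.le_ceil (τ * Real.log L)
  have hsge := Nat.le_ceil (σ * Real.log L)
  set t := ⌈τ * Real.log L⌉₊
  set s := ⌈σ * Real.log L⌉₊
  rw [← ha] at htle
  rw [← hb] at hsle
  refine ⟨fun o ho => ?_, fun o ho ε hε hε1 o' ho' => ?_,
    B.le_toOuterMeasure_construct p hδ0 h0 h2 hδ1 S hS hL κ htge hsge⟩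
  · have h1 : o.2 ≤ t * (t + S.length) + t * t + s * (2 * t) :=
      (B.cost_construct_le ho).2.trans (by gcongr; exact Nat.le_mul_self t)
    have h3 : (o.2 : ℝ) ≤ t * (t + S.length) + t * t + s * (2 * t) := by exact_mod_cast h1
    calc (o.2 : ℝ) ≤ t * (t + S.length) + t * t + s * (2 * t) := h3
      _ ≤ a * Real.log L * (a * Real.log L + S.length) + a * Real.log L * (a * Real.log L) +
          b * Real.log L * (2 * (a * Real.log L)) := by gcongr
      _ = (2 * a ^ 2 + 2 * a * b) * Real.log L ^ 2 + a * (S.length * Real.log L) := by ring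
      _ ≤ ((2 * a ^ 2 + 2 * a * b + a) + 2 * (2 * a + b)) * Real.log L ^ 2 +
          ((2 * a ^ 2 + 2 * a * b + a) + 2 * (2 * a + b)) * (S.length * Real.log L) := by
          have hab := mul_pos ha0 hb0
          refine add_le_add (mul_le_mul_of_nonneg_right ?_ (sq_nonneg _))
            (mul_le_mul_of_nonneg_right ?_ (by positivity)) <;> linarith [sq_nonneg a]
      _ = _ := by ring
  · have h1 := B.cost_draw_le ho'
    rw [(B.cost_construct_le ho).1] at h1
    have h3 : (o'.2 : ℝ) ≤ ⌈Real.log ε / Real.log (1 / 2)⌉₊ * (2 * t + s) := by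
      exact_mod_cast h1
    have h4 : 0 ≤ Real.log (1 / ε) := Real.log_nonneg (by rw [le_div_iff₀ hε]; linarith)
    calc (o'.2 : ℝ) ≤ ⌈Real.log ε / Real.log (1 / 2)⌉₊ * (2 * t + s) := h3
      _ ≤ 2 * (1 + Real.log (1 / ε)) * (2 * (a * Real.log L) + b * Real.log L) := by
          gcongr
          exact natCeil_log_div_log_half_le hε hε1
      _ = 2 * (2 * a + b) * ((1 + Real.log (1 / ε)) * Real.log L) := by ring
      _ ≤ _ := by
          gcongr
          linarith [mul_pos ha0 hb0, sq_nonneg a]
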